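/- A \emph{Berge cycle} of length $\ell$ is a family of distinct hyperedges $H_0,\dots,H_{\ell-1}$ for which there are distinct vertices $v_0,\dots,v_{\ell-1}$ such that $\{v_i,v_{i+1}\}\subseteq H_i$ for all $0\le i\le \ell-1$ (indices modulo $\ell$). A hypergraph is \emph{linear} if every two distinct hyperedges meet in at most one vertex. \textbf{Theorem.} Let $k\ge 2$ be an integer. Every linear 3-uniform hypergraph on $n$ vertices that contains no Berge cycle of length $2k+1$ has at most $$2k\,n^{1+1/k}+9kn$$ hyperedges. -/

import Mathlib

/-- A hypergraph is `r`-uniform if every hyperedge has exactly `r` vertices. For `r = 0` the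
junk value `ncard = 0` of an infinite set is ruled out by the finiteness clause. -/
def Hypergraph.IsUniform {α : Type*} (H : Hypergraph α) (r : ℕ) : Prop :=
  ∀ e ∈ H.edgeSet, e.Finite ∧ e.ncard = r

/-- A hypergraph is linear if any two distinct hyperedges meet in at most one vertex. -/
def Hypergraph.IsLinear {α : Type*} (H : Hypergraph α) : Prop :=
  ∀ e ∈ H.edgeSet, ∀ f ∈ H.edgeSet, e ≠ f → (e ∩ f).Subsingleton

/-- A family `e 0, …, e (ℓ - 1)` of sets is a Berge cycle of length `ℓ` if its members are distinct
and there are distinct vertices `v 0, …, v (ℓ - 1)` such that `v i` and `v (i + 1)` lie in `e i`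
for every `i`, the indices being taken modulo `ℓ` (`finRotate ℓ` is the cyclic successor). -/
def IsBergeCycle {α : Type*} (ℓ : ℕ) (e : Fin ℓ → Set α) : Prop :=
  Function.Injective e ∧
    ∃ v : Fin ℓ → α, Function.Injective v ∧ ∀ i, {v i, v (finRotate ℓ i)} ⊆ e i

/-- The hypergraph `H` contains a Berge cycle of length `ℓ` consisting of hyperedges of `H`. -/
def Hypergraph.HasBergeCycle {α : Type*} (H : Hypergraph α) (ℓ : ℕ) : Prop :=
  ∃ e : Fin ℓ → Set α, (∀ i, e i ∈ H.edgeSet) ∧ IsBergeCycle ℓ e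

/-! Put γ = n^(1/k). With too many hyperedges, some nonempty vertex set `W` induces a subhypergraph
with all degrees above 2kγ + 9k. Arrange vertices of `W` in levels around some `x`, each hanging
from its parent by a hyperedge of its own, its link (`exists_isLayering`). Each level turns out to
be more than γ times as large as the one before, so level k has more than γ^k = n vertices, which is
absurd.

The growth comes from counting incidences with a level (`IsLayering.sum_degree_le`). Links are no
more numerous than vertices, so the point is that at most 2k - 2 times the size of a level many
non-links have two vertices on it (`IsLayering.card_denseFree_le`). Otherwise one pair from each
such hyperedge yields, by linearity, a graph on the level dense enough for a cycle of length at
least 2k with a chord (`exists_chorded_cycle`). Let j + 1 be the least number of parent steps that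
merges the whole cycle. Colour its vertices by whether their j-th ancestor is a fixed one; both
colours occur. A path of length 2(k - 1 - j) + 1 with ends of different colours
(`exists_bichromatic_path`) is closed by two branches of j + 1 links to a Berge cycle of length 2k +
1.

The chord matters: on a bare cycle a colouring whose period divides both the cycle length and the
path length admits no such path along the cycle. -/

/-! ### Bichromatic paths in a cycle with a chord -/

/-- A periodic two-colouring of the integers, compatible with an odd period `p < L` and with the
colour identities forced by paths of length `p` through a chord `{0, r}` of a cycle of length `L`,
is constant. -/
lemma periodic_coloring_constant (X : ℤ → Prop) (L p r : ℤ)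
    (hL : ∀ v, X (v + L) ↔ X v) (hp : ∀ v, X (v + p) ↔ X v) (hodd : Odd p) (hp0 : 0 < p)
    (hpL : p < L) (hr : 2 ≤ r) (hrL : r ≤ L - 2)
    (h1 : ∀ s t, 0 ≤ s → 0 ≤ t → s + t = p - 1 → r + p - 1 < L → (X (-s) ↔ X (r + t)))
    (h2 : ∀ s t, 0 ≤ s → 0 ≤ t → s + t = p - 1 → (L - r) + p - 1 < L → (X s ↔ X (r - t)))
    (h3 : ∀ s t, 0 ≤ s → 0 ≤ t → s + t = p - 1 → t ≤ r - 1 → s ≤ L - r - 1 →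
      (X (-s) ↔ X (r - t)))
    (h4 : ∀ s t, 0 ≤ s → 0 ≤ t → s + t = p - 1 → t ≤ r - 1 → s ≤ L - r - 1 →
      (X (r + s) ↔ X t)) (u v : ℤ) : X u ↔ X v := by
  -- The periods of `X` form a subgroup of ℤ, and `m` is its nonnegative generator.
  obtain ⟨m, hm0, hper, hmin⟩ : ∃ m : ℤ, 0 ≤ m ∧ (∀ j v, X (v + m * j) ↔ X v) ∧
      ∀ d, (∀ v, X (v + d) ↔ X v) → m ∣ d := by
    let P : AddSubgroup ℤ :=
      { carrier := {d | ∀ v, X (v + d) ↔ X v}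
        zero_mem' := by simp
        add_mem' := fun {a b} ha hb v => by
          rw [← add_assoc, hb (v + a), ha v]
        neg_mem' := fun {a} ha v => by
          rw [← ha (v + -a)]
          simp }
    obtain ⟨a, ha⟩ := Int.subgroup_cyclic P
    have key : ∀ d, d ∈ P ↔ a ∣ d := fun d => by
      rw [ha, AddSubgroup.mem_closure_singleton]
      constructor
      · rintro ⟨j, rfl⟩
        exact ⟨j, by simp [mul_comm]⟩
      · rintro ⟨j, rfl⟩
        exact ⟨j, by simp [mul_comm]⟩
    refine ⟨|a|, abs_nonneg a, fun j v => ?_, fun d hd => ?_⟩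
    · have : |a| * j ∈ P := (key _).2 (Dvd.dvd.mul_right (by simp) j)
      exact this v
    · rw [abs_dvd]
      exact (key d).1 hd
  have hmp : m ∣ p := hmin p hp
  have hmL : m ∣ L := hmin L hL
  have hmpos : 0 < m := by
    rcases hm0.lt_or_eq with h | h
    · exact h
    · rw [← h, zero_dvd_iff] at hmp
      omega
  have hmlep : m ≤ p := Int.le_of_dvd hp0 hmp
  -- `L - p` is a positive period as well; this bound makes windows of length `m` fit into the
  -- ranges that `h1` to `h4` allow.
  have hmleL : m ≤ L - p := Int.le_of_dvd (by omega) (dvd_sub hmL hmp)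
  have hcong : ∀ a b, m ∣ a - b → (X a ↔ X b) := by
    rintro a b ⟨j, hj⟩
    rw [← hper j b, ← hj]
    simp
  -- every residue has a representative in any window of length `m`
  have hrep : ∀ lo w : ℤ, ∃ s, lo ≤ s ∧ s ≤ lo + m - 1 ∧ m ∣ w - s := fun lo w => by
    refine ⟨lo + (w - lo) % m, ?_, ?_, ?_⟩
    · have := Int.emod_nonneg (w - lo) hmpos.ne'
      omega
    · have := Int.emod_lt_of_pos (w - lo) hmpos
      omega
    · have := Int.dvd_self_sub_emod (x := w - lo) (m := m)
      rwa [sub_sub] at this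
  -- If `r < m`, then `h1` yields the period `r - 1`, strictly between 0 and `m`. If `L - r < m`,
  -- then `h2` likewise yields the period `L - r - 1`.
  by_cases hrm : r < m
  · have : m ∣ r - 1 := hmin _ fun v => by
      obtain ⟨s, hs0, hs1, hs⟩ := hrep 0 (-v)
      have e1 := h1 s (p - 1 - s) hs0 (by omega) (by omega) (by omega)
      rw [hcong v (-s), e1]
      · refine hcong _ _ ?_
        have : v + (r - 1) - (r + (p - 1 - s)) = -(-v - s) - p := by ring
        rw [this]
        exact dvd_sub (hs.neg_right) hmp
      · have : v - -s = - (-v - s) := by ring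
        rw [this]
        exact hs.neg_right
    have := Int.le_of_dvd (by omega) this
    omega
  by_cases hrm' : L - r < m
  · have : m ∣ r + 1 := hmin _ fun v => by
      obtain ⟨s, hs0, hs1, hs⟩ := hrep 0 v
      have e1 := h2 s (p - 1 - s) hs0 (by omega) (by omega) (by omega)
      rw [hcong v s hs, e1]
      refine hcong _ _ ?_
      have : v + (r + 1) - (r - (p - 1 - s)) = (v - s) + p := by ring
      rw [this]
      exact dvd_add hs hmp
    have h5 : m ∣ L - r - 1 := by
      rw [sub_sub]
      exact dvd_sub hmL this
    have := Int.le_of_dvd (by omega) h5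
    omega
  -- Now `r` and `L - r` are at least `m`, so `s` can take every residue, starting from the least
  -- value with `t ≤ r - 1`. The reflections `hA` and `hB` compose to the translation by 2, and the
  -- odd period `p` then forces `m = 1`.
  have hA : ∀ v, X v ↔ X (r + 1 - v) := fun v => by
    obtain ⟨s, hs0, hs1, hs⟩ := hrep (max 0 (p - r)) (-v)
    have e1 := h3 s (p - 1 - s) (by omega) (by omega) (by omega) (by omega) (by omega)
    rw [hcong v (-s), e1]
    · refine hcong _ _ ?_
      have : r - (p - 1 - s) - (r + 1 - v) = -(-v - s) - p := by ring
      rw [this]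
      exact dvd_sub (hs.neg_right) hmp
    · have : v - -s = - (-v - s) := by ring
      rw [this]
      exact hs.neg_right
  have hB : ∀ v, X v ↔ X (r - 1 - v) := fun v => by
    obtain ⟨s, hs0, hs1, hs⟩ := hrep (max 0 (p - r)) (-v - 1)
    have e1 := h4 s (p - 1 - s) (by omega) (by omega) (by omega) (by omega) (by omega)
    rw [hcong (r - 1 - v) (r + s), e1]
    · refine hcong _ _ ?_
      have : v - (p - 1 - s) = -(-v - 1 - s) - p := by ring
      rw [this]
      exact dvd_sub (hs.neg_right) hmp
    · have : r - 1 - v - (r + s) = -v - 1 - s := by ring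
      rwa [this]
  have h2' : m ∣ 2 := hmin 2 fun v => by
    rw [hA (v + 2), hB v]
    have : r + 1 - (v + 2) = r - 1 - v := by ring
    rw [this]
  have hm1 : m = 1 := by
    have := Int.le_of_dvd (by norm_num) h2'
    rcases (by omega : m = 1 ∨ m = 2) with h | h
    · exact h
    · rw [h] at hmp
      rcases hodd with ⟨q, rfl⟩
      omega
  exact hcong u v (by simp [hm1])

/-- A path of length `p` in the relation `R`. -/
def IsRelPath {α : Type*} (R : α → α → Prop) (p : ℕ) (q : ℕ → α) : Prop :=
  Set.InjOn q (Set.Iic p) ∧ ∀ i < p, R (q i) (q (i + 1))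

/-- `c` winds around a cycle of length `L` in the relation `R`. -/
def IsRelCycle {α : Type*} (R : α → α → Prop) (L : ℤ) (c : ℤ → α) : Prop :=
  (∀ i j, c i = c j ↔ L ∣ i - j) ∧ ∀ i, R (c i) (c (i + 1))

lemma IsRelCycle.reflect {α : Type*} {R : α → α → Prop} (hR : ∀ a b, R a b → R b a) {L : ℤ}
    {c : ℤ → α} (hc : IsRelCycle R L c) (a : ℤ) : IsRelCycle R L (fun z => c (a - z)) := by
  refine ⟨fun i j => ?_, fun i => ?_⟩
  · rw [hc.1, dvd_sub_comm]
    ring_nf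
  · have := hc.2 (a - (i + 1))
    rw [show a - (i + 1) + 1 = a - i by ring] at this
    exact hR _ _ this

lemma not_dvd_of_lt {L a : ℤ} (h0 : a ≠ 0) (h1 : a < L) (h2 : -L < a) : ¬ L ∣ a := fun h =>
  h0 (Int.eq_zero_of_abs_lt_dvd h (abs_lt.2 ⟨h2, h1⟩))

/-- Follow a cycle up to the vertex `0`, traverse the chord to `r`, and go on in the direction
of `ε`. -/
lemma chord_path {α : Type*} {R : α → α → Prop} (hR : ∀ a b, R a b → R b a) {L : ℤ}
    {c : ℤ → α} (hc : IsRelCycle R L c) {r : ℤ} (hr : R (c 0) (c r)) (hr0 : 0 < r)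
    (s t : ℕ) (ε : ℤ) (hε : ε = 1 ∧ r + t + s < L ∨ ε = -1 ∧ (t : ℤ) < r ∧ s + r < L) :
    ∃ q, IsRelPath R (s + 1 + t) q ∧ (∀ i, ∃ z, q i = c z) ∧ q 0 = c (-s) ∧
      q (s + 1 + t) = c (r + ε * t) := by
  refine ⟨fun i => if i ≤ s then c (-s + i) else c (r + ε * (i - s - 1)), ⟨?_, ?_⟩, ?_, ?_, ?_⟩
  · intro i hi j hj hij
    simp only [Set.mem_Iic] at hi hj
    dsimp only at hij
    by_contra hne
    -- By `hε`, the integers visited are distinct and span less than `L`.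
    split_ifs at hij with h1 h2 h2 <;> rw [hc.1] at hij <;> revert hij <;>
      apply not_dvd_of_lt <;> rcases hε with ⟨rfl, _⟩ | ⟨rfl, _⟩ <;> omega
  · intro i hi
    dsimp only
    rcases lt_trichotomy i s with h | h | h
    · rw [if_pos (by omega), if_pos (by omega)]
      convert hc.2 (-s + i) using 2
      push_cast
      ring
    · rw [if_pos (by omega), if_neg (by omega), h]
      push_cast
      convert hr using 2 <;> ring
    · rw [if_neg (by omega), if_neg (by omega)]
      rcases hε with ⟨rfl, _⟩ | ⟨rfl, _⟩
      · convert hc.2 (r + 1 * (i - s - 1)) using 2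
        push_cast
        ring
      · apply hR
        convert hc.2 (r + -1 * ((i + 1 : ℕ) - s - 1)) using 2
        push_cast
        ring
  · intro i
    dsimp only
    split_ifs
    · exact ⟨_, rfl⟩
    · exact ⟨_, rfl⟩
  · simp
  · dsimp only
    rw [if_neg (by omega)]
    push_cast
    ring_nf

/-- In a cycle with a chord, a nonconstant two-colouring has paths of every odd length with ends of
different colours. -/
lemma exists_bichromatic_path {α : Type*} {R : α → α → Prop} (hR : ∀ a b, R a b → R b a) {L : ℤ}
    {c : ℤ → α} (hc : IsRelCycle R L c) {r : ℤ} (hr : R (c 0) (c r)) (hr2 : 2 ≤ r)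
    (hrL : r ≤ L - 2) (χ : α → Prop) (hχ : ∃ a b, ¬ (χ (c a) ↔ χ (c b))) (p : ℕ) (hp : Odd p)
    (hpL : (p : ℤ) < L) :
    ∃ q, IsRelPath R p q ∧ (∀ i, ∃ z, q i = c z) ∧ ¬ (χ (q 0) ↔ χ (q p)) := by
  by_contra hcon
  push Not at hcon
  obtain ⟨a, b, hab⟩ := hχ
  have hcL : ∀ a b, L ∣ a - b → (χ (c a) ↔ χ (c b)) := fun a b h => by rw [(hc.1 a b).2 h]
  have hp0 : 0 < p := hp.pos
  have hc0 := hc.reflect hR 0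
  have hcr := hc.reflect hR r
  have hend : ∀ c' : ℤ → α, IsRelCycle R L c' → (∀ z, ∃ z', c' z = c z') → ∀ r' : ℤ, 0 < r' →
      R (c' 0) (c' r') → ∀ s t : ℤ, 0 ≤ s → 0 ≤ t → s + t = p - 1 → ∀ ε : ℤ,
      (ε = 1 ∧ r' + t + s < L ∨ ε = -1 ∧ t < r' ∧ s + r' < L) →
      (χ (c' (-s)) ↔ χ (c' (r' + ε * t))) := by
    intro c' hc' hcc' r' hr' hch s t hs ht hst ε hε
    lift s to ℕ using hs
    lift t to ℕ using ht
    obtain ⟨q, hq, hqc, h0, h1⟩ := chord_path hR hc' hch hr' s t ε hε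
    have hpst : p = s + 1 + t := by omega
    have := hcon q (hpst ▸ hq) fun i => by
      obtain ⟨z, hz⟩ := hqc i
      rw [hz]
      exact hcc' z
    rwa [hpst, h0, h1] at this
  -- Period `p` comes from arcs of the cycle. The chord identities come from the cycle and its
  -- reflections in 0 and in `r`; reflected in 0, the chord joins 0 to `L - r`.
  refine hab (periodic_coloring_constant (fun z => χ (c z)) L p r ?_ ?_ ?_ ?_ hpL hr2 hrL
    ?_ ?_ ?_ ?_ a b)
  · exact fun v => hcL _ _ (by simp)
  · intro v
    have := hcon (fun i => c (v + i)) ⟨?_, ?_⟩ fun i => ⟨_, rfl⟩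
    · simpa using this.symm
    · intro i hi j hj hij
      simp only [Set.mem_Iic] at hi hj
      dsimp only at hij
      by_contra hne
      rw [hc.1] at hij
      revert hij
      apply not_dvd_of_lt <;> omega
    · intro i _
      have := hc.2 (v + i)
      rw [add_assoc] at this
      exact_mod_cast this
  · exact_mod_cast hp
  · exact_mod_cast hp0
  · intro s t hs ht hst hlt
    simpa using hend c hc (fun z => ⟨z, rfl⟩) r (by omega) hr s t hs ht hst 1
      (Or.inl ⟨rfl, by omega⟩)
  · intro s t hs ht hst hlt
    have hcc : c (0 - (L - r)) = c r := (hc.1 _ _).2 ⟨-1, by ring⟩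
    have := hend _ hc0 (fun z => ⟨_, rfl⟩) (L - r) (by omega) (by
      simpa only [sub_self, hcc] using hr) s t hs ht hst 1 (Or.inl ⟨rfl, by omega⟩)
    rw [show (0 : ℤ) - -s = s by ring] at this
    rw [this]
    exact hcL _ _ ⟨-1, by ring⟩
  · intro s t hs ht hst h1 h2
    have := hend c hc (fun z => ⟨z, rfl⟩) r (by omega) hr s t hs ht hst (-1)
      (Or.inr ⟨rfl, by omega, by omega⟩)
    rwa [show r + -1 * t = r - t by ring] at this
  · intro s t hs ht hst h1 h2
    have := hend _ hcr (fun z => ⟨_, rfl⟩) r (by omega) (by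
      simpa using hR _ _ hr) s t hs ht hst (-1) (Or.inr ⟨rfl, by omega, by omega⟩)
    rwa [show r - -s = r + s by ring, show r - (r + -1 * t) = t by ring] at this

/-! ### Minimum degree and chorded cycles -/

open Classical in
/-- A family of more than `d |V|` nonempty subsets of `V` has a nonempty induced subfamily all of
whose degrees exceed `d`. -/
lemma exists_large_min_degree {α : Type*} (V : Finset α) (E : Finset (Finset α)) (d : ℝ)
    (hne : ∀ e ∈ E, e.Nonempty) (hsub : ∀ e ∈ E, e ⊆ V) (hcard : d * V.card < E.card) :
    ∃ W ⊆ V, W.Nonempty ∧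
      ∀ v ∈ W, d < ((E.filter (fun e => e ⊆ W)).filter (fun e => v ∈ e)).card := by
  -- In a smallest set that is still dense, deleting a vertex of degree at most `d` would leave a
  -- smaller dense set.
  let good : Finset (Finset α) :=
    V.powerset.filter fun W => d * W.card < (E.filter (fun e => e ⊆ W)).card
  have hV : V ∈ good := by
    simp only [good, Finset.mem_filter, Finset.mem_powerset, Finset.Subset.refl, true_and]
    rwa [Finset.filter_true_of_mem hsub]
  obtain ⟨W, hW, hmin⟩ := Finset.exists_min_image good Finset.card ⟨V, hV⟩
  obtain ⟨hWV, hWd⟩ := Finset.mem_filter.1 hW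
  rw [Finset.mem_powerset] at hWV
  refine ⟨W, hWV, ?_, fun v hv => ?_⟩
  · rw [Finset.nonempty_iff_ne_empty]
    rintro rfl
    have : E.filter (fun e => e ⊆ ∅) = ∅ := by
      refine Finset.filter_false_of_mem fun e he h => ?_
      exact (hne e he).ne_empty (Finset.subset_empty.1 h)
    rw [this] at hWd
    simp at hWd
  · have h1 : ¬ d * (W.erase v).card < (E.filter (fun e => e ⊆ W.erase v)).card := fun h => by
      have := hmin (W.erase v) (Finset.mem_filter.2
        ⟨Finset.mem_powerset.2 ((Finset.erase_subset _ _).trans hWV), h⟩)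
      exact absurd (Finset.card_erase_lt_of_mem hv) (not_lt.2 this)
    have h2 : (E.filter (fun e => e ⊆ W)).filter (fun e => ¬ v ∈ e) =
        E.filter (fun e => e ⊆ W.erase v) := by
      ext e
      simp only [Finset.mem_filter, Finset.subset_erase, and_assoc]
    have h3 := Finset.card_filter_add_card_filter_not (s := E.filter (fun e => e ⊆ W))
      (fun e => v ∈ e)
    rw [h2] at h3
    have h4 : ((W.erase v).card : ℝ) = W.card - 1 := by
      rw [Finset.card_erase_of_mem hv, Nat.cast_sub (Finset.card_pos.2 ⟨v, hv⟩)]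
      simp
    have h5 : (((E.filter (fun e => e ⊆ W)).filter (fun e => v ∈ e)).card : ℝ) +
        (E.filter (fun e => e ⊆ W.erase v)).card = (E.filter (fun e => e ⊆ W)).card := by
      exact_mod_cast h3
    rw [h4] at h1
    linarith

/-- A finite graph contains a path whose first vertex has all its neighbours on the path. -/
lemma exists_saturated_path {α : Type*} (W : Finset α) (R : α → α → Prop)
    (hR : ∀ a b, R a b → R b a) (hW : ∀ a b, R a b → a ∈ W) (hne : W.Nonempty) :
    ∃ t q, IsRelPath R t q ∧ (∀ i ≤ t, q i ∈ W) ∧ ∀ b, R (q 0) b → ∃ i ≤ t, q i = b := by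
  by_contra hcon
  push Not at hcon
  -- Otherwise every path extends at its first vertex, eventually to more than `W.card` vertices.
  have key : ∀ t, ∃ q, IsRelPath R t q ∧ ∀ i ≤ t, q i ∈ W := by
    intro t
    induction t with
    | zero =>
      obtain ⟨w, hw⟩ := hne
      exact ⟨fun _ => w, ⟨fun i hi j hj _ => by
        simp only [Set.mem_Iic] at hi hj
        omega, by simp⟩, fun _ _ => hw⟩
    | succ t ih =>
      obtain ⟨q, hq, hqW⟩ := ih
      obtain ⟨b, hb, hbq⟩ := hcon t q hq hqW
      refine ⟨fun i => if i = 0 then b else q (i - 1), ⟨?_, ?_⟩, ?_⟩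
      · intro i hi j hj hij
        simp only [Set.mem_Iic] at hi hj
        dsimp only at hij
        split_ifs at hij with h1 h2 h2
        · omega
        · exact absurd hij.symm (hbq _ (by omega))
        · exact absurd hij (hbq _ (by omega))
        · have := hq.1 (Set.mem_Iic.2 (by omega)) (Set.mem_Iic.2 (by omega)) hij
          omega
      · intro i hi
        rcases i with _ | i
        · simpa using hR _ _ hb
        · simpa using hq.2 i (by omega)
      · intro i hi
        dsimp only
        split_ifs
        · exact hW _ _ (hR _ _ hb)
        · exact hqW _ (by omega)
  obtain ⟨q, hq, hqW⟩ := key W.card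
  have := Finset.card_le_card_of_injOn (s := Finset.range (W.card + 1)) q
    (fun i hi => hqW i (by simpa [Nat.lt_succ_iff] using hi))
    (fun i hi j hj h => hq.1 (by simpa [Nat.lt_succ_iff] using hi)
      (by simpa [Nat.lt_succ_iff] using hj) h)
  simp at this

open Classical in
/-- A graph with more than `d |V|` edges, `d ≥ 2`, contains a cycle of length at least `d + 2`
with a chord. -/
lemma exists_chorded_cycle {α : Type*} (V : Finset α) (P : Finset (Finset α)) (d : ℕ) (hd : 2 ≤ d)
    (h2 : ∀ e ∈ P, e.card = 2) (hsub : ∀ e ∈ P, e ⊆ V) (hcard : d * V.card < P.card) :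
    ∃ (L : ℤ) (c : ℤ → α) (r : ℤ), (d : ℤ) + 2 ≤ L ∧ 2 ≤ r ∧ r ≤ L - 2 ∧
      IsRelCycle (fun a b => a ≠ b ∧ {a, b} ∈ P) L c ∧ (c 0 ≠ c r ∧ {c 0, c r} ∈ P) := by
  obtain ⟨W, hWV, hWne, hdeg⟩ := exists_large_min_degree V P d
    (fun e he => Finset.card_pos.1 (by rw [h2 e he]; norm_num)) hsub (by exact_mod_cast hcard)
  set P' := P.filter (fun e => e ⊆ W) with hP'
  let R : α → α → Prop := fun a b => a ≠ b ∧ {a, b} ∈ P'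
  have hR : ∀ a b, R a b → R b a := fun a b h => ⟨h.1.symm, by rw [Finset.pair_comm]; exact h.2⟩
  have hRW : ∀ a b, R a b → a ∈ W := fun a b h =>
    (Finset.mem_filter.1 h.2).2 (by simp)
  obtain ⟨t, q, hq, hqW, hsat⟩ := exists_saturated_path W R hR hRW hWne
  let J := (Finset.Icc 1 t).filter fun j => R (q 0) (q j)
  have hJ : d < J.card := by
    have h := hdeg (q 0) (hqW 0 (Nat.zero_le _))
    have h' : d < (P'.filter (fun e => q 0 ∈ e)).card := by exact_mod_cast h
    refine h'.trans_le ((Finset.card_le_card (t := J.image fun j => {q 0, q j}) ?_).trans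
      Finset.card_image_le)
    intro e he
    obtain ⟨heP, h0e⟩ := Finset.mem_filter.1 he
    obtain ⟨b, hb0, hbe⟩ : ∃ b, q 0 ≠ b ∧ e = {q 0, b} := by
      obtain ⟨x, y, hxy, rfl⟩ := Finset.card_eq_two.1 (h2 e (Finset.mem_filter.1 heP).1)
      rcases Finset.mem_insert.1 h0e with h | h
      · exact ⟨y, by rw [h]; exact hxy, by rw [h]⟩
      · rw [Finset.mem_singleton] at h
        exact ⟨x, by rw [h]; exact hxy.symm, by rw [h, Finset.pair_comm]⟩
    have hRb : R (q 0) b := ⟨hb0, hbe ▸ heP⟩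
    obtain ⟨i, hi, hib⟩ := hsat b hRb
    refine Finset.mem_image.2 ⟨i, Finset.mem_filter.2 ⟨Finset.mem_Icc.2 ⟨?_, hi⟩, ?_⟩, ?_⟩
    · rcases Nat.eq_zero_or_pos i with h | h
      · rw [h] at hib
        exact absurd hib hb0
      · exact h
    · rw [hib]
      exact hRb
    · rw [hib, hbe]
  have hJne : J.Nonempty := Finset.card_pos.1 (by omega)
  -- The farthest neighbour of `q 0` closes the cycle. As `J` has at least three elements, a
  -- neighbour other than `q 1` and `q M` gives the chord.
  set M := J.max' hJne with hM
  have hMJ : M ∈ J := J.max'_mem hJne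
  obtain ⟨hMI, hMR⟩ := Finset.mem_filter.1 hMJ
  obtain ⟨hM1, hMt⟩ := Finset.mem_Icc.1 hMI
  have hJsub : J ⊆ Finset.Icc 1 M := fun j hj => Finset.mem_Icc.2
    ⟨(Finset.mem_Icc.1 (Finset.mem_filter.1 hj).1).1, J.le_max' j hj⟩
  have hdM : d < M := by
    have := Finset.card_le_card hJsub
    simp only [Nat.card_Icc] at this
    omega
  obtain ⟨r, hr⟩ : ((J.erase 1).erase M).Nonempty := by
    refine Finset.card_pos.1 ?_
    have a1 := Finset.pred_card_le_card_erase (s := J) (a := 1)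
    have a2 := Finset.pred_card_le_card_erase (s := J.erase 1) (a := M)
    omega
  simp only [Finset.mem_erase] at hr
  obtain ⟨hrM, hr1, hrJ⟩ := hr
  have hrI := Finset.mem_Icc.1 (hJsub hrJ)
  have hRr := (Finset.mem_filter.1 hrJ).2
  have hsubP : ∀ a b, R a b → a ≠ b ∧ {a, b} ∈ P := fun a b h =>
    ⟨h.1, (Finset.mem_filter.1 h.2).1⟩
  have hLpos : (0 : ℤ) < M + 1 := by positivity
  refine ⟨M + 1, fun z => q (z % (M + 1)).toNat, r, by omega, by omega, by omega, ⟨?_, ?_⟩, ?_⟩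
  · intro i j
    have hi0 := Int.emod_nonneg i hLpos.ne'
    have hj0 := Int.emod_nonneg j hLpos.ne'
    have hi1 := Int.emod_lt_of_pos i hLpos
    have hj1 := Int.emod_lt_of_pos j hLpos
    rw [Int.dvd_iff_emod_eq_zero, ← Int.emod_eq_emod_iff_emod_sub_eq_zero]
    constructor
    · intro h
      have := hq.1 (Set.mem_Iic.2 (by omega)) (Set.mem_Iic.2 (by omega)) h
      omega
    · intro h
      dsimp only
      rw [h]
  · intro i
    apply hsubP
    have hi0 := Int.emod_nonneg i hLpos.ne'
    have hi1 := Int.emod_lt_of_pos i hLpos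
    have hadd : (i + 1) % (M + 1 : ℤ) = (i % (M + 1) + 1) % (M + 1) := by rw [Int.emod_add_emod]
    dsimp only
    rcases eq_or_ne (i % (M + 1 : ℤ)) M with h | h
    · rw [hadd, h, Int.emod_self]
      simpa using hR _ _ hMR
    · rw [hadd, Int.emod_eq_of_lt (a := i % (M + 1) + 1) (by omega) (by omega),
        Int.toNat_add hi0 (by norm_num)]
      exact hq.2 _ (by omega)
  · have e0 : ((0 : ℤ) % (M + 1)).toNat = 0 := by simp
    have e1 : ((r : ℤ) % (M + 1)).toNat = r := by
      rw [Int.emod_eq_of_lt (by omega) (by omega)]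
      simp
    dsimp only
    rw [e0, e1]
    exact hsubP _ _ hRr

/-! ### Berge paths -/

/-- The finite family `E` contains a Berge cycle of length `ℓ`, indexed by natural numbers. -/
def HasCyclicBerge {α : Type*} (E : Finset (Finset α)) (ℓ : ℕ) : Prop :=
  ∃ (e : ℕ → Finset α) (v : ℕ → α), Set.InjOn e (Set.Iio ℓ) ∧ Set.InjOn v (Set.Iio ℓ) ∧
    ∀ i < ℓ, e i ∈ E ∧ v i ∈ e i ∧ v ((i + 1) % ℓ) ∈ e i

/-- A Berge path with `p` hyperedges, all of them from `E`. -/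
structure IsBergePath {α : Type*} (E : Finset (Finset α)) (p : ℕ) (q : ℕ → α)
    (e : ℕ → Finset α) : Prop where
  vertex_inj : Set.InjOn q (Set.Iic p)
  edge_inj : Set.InjOn e (Set.Iio p)
  edge_mem : ∀ i < p, e i ∈ E
  left_mem : ∀ i < p, q i ∈ e i
  right_mem : ∀ i < p, q (i + 1) ∈ e i

/-- Close up a Berge path through one further vertex `w` and two further hyperedges. -/
lemma IsBergePath.close {α : Type*} {E : Finset (Finset α)} {p : ℕ} {q : ℕ → α}
    {e : ℕ → Finset α} (h : IsBergePath E p q e) {w : α} (hw : ∀ i ≤ p, q i ≠ w)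
    {f g : Finset α} (hf : f ∈ E) (hg : g ∈ E) (hfg : f ≠ g) (hfe : ∀ i < p, e i ≠ f)
    (hge : ∀ i < p, e i ≠ g) (hpf : q p ∈ f) (hwf : w ∈ f) (hwg : w ∈ g) (hg0 : q 0 ∈ g) :
    HasCyclicBerge E (p + 2) := by
  refine ⟨fun i => if i < p then e i else if i = p then f else g,
    fun i => if i ≤ p then q i else w, ?_, ?_, ?_⟩
  · intro i hi j hj hij
    simp only [Set.mem_Iio] at hi hj
    dsimp only at hij
    split_ifs at hij with h1 h2 h3 h4 h5 h6 h7 h8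
    · exact h.edge_inj h1 h2 hij
    · exact absurd hij (hfe _ h1)
    · exact absurd hij (hge _ h1)
    · exact absurd hij.symm (hfe _ h5)
    · omega
    · exact absurd hij hfg
    · exact absurd hij.symm (hge _ h7)
    · exact absurd hij.symm hfg
    · omega
  · intro i hi j hj hij
    simp only [Set.mem_Iio] at hi hj
    dsimp only at hij
    split_ifs at hij with h1 h2 h3
    · exact h.vertex_inj h1 h2 hij
    · exact absurd hij (hw _ h1)
    · exact absurd hij.symm (hw _ h3)
    · omega
  · intro i hi
    dsimp only
    rcases lt_trichotomy i p with h1 | rfl | h1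
    · rw [Nat.mod_eq_of_lt (by omega), if_pos h1, if_pos h1.le, if_pos (by omega)]
      exact ⟨h.edge_mem i h1, h.left_mem i h1, h.right_mem i h1⟩
    · rw [Nat.mod_eq_of_lt (by omega)]
      simpa using ⟨hf, hpf, hwf⟩
    · obtain rfl : i = p + 1 := by omega
      rw [Nat.mod_self]
      simpa using ⟨hg, hwg, hg0⟩

/-- Extend a Berge path at both ends. -/
lemma IsBergePath.extend {α : Type*} {E : Finset (Finset α)} {p : ℕ} {q : ℕ → α}
    {e : ℕ → Finset α} (h : IsBergePath E p q e) {a b : α} (ha : ∀ i ≤ p, q i ≠ a)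
    (hb : ∀ i ≤ p, q i ≠ b) (hab : a ≠ b)
    {f g : Finset α} (hf : f ∈ E) (hg : g ∈ E) (hfg : f ≠ g) (hfe : ∀ i < p, e i ≠ f)
    (hge : ∀ i < p, e i ≠ g) (haf : a ∈ f) (h0f : q 0 ∈ f) (hpg : q p ∈ g) (hbg : b ∈ g) :
    IsBergePath E (p + 2) (fun i => if i = 0 then a else if i ≤ p + 1 then q (i - 1) else b)
      (fun i => if i = 0 then f else if i ≤ p then e (i - 1) else g) := by
  constructor
  · intro i hi j hj hij
    simp only [Set.mem_Iic] at hi hj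
    dsimp only at hij
    have key : ∀ i j, i ≤ p + 1 → j ≤ p + 1 → ¬ i = 0 → ¬ j = 0 → q (i - 1) = q (j - 1) →
        i = j := by
      intro i j hi hj hi0 hj0 hij
      have := h.vertex_inj (Set.mem_Iic.2 (by omega)) (Set.mem_Iic.2 (by omega)) hij
      omega
    split_ifs at hij with h1 h2 h3 h4 h5 h6 h7 h8
    · omega
    · exact absurd hij.symm (ha _ (by omega))
    · exact absurd hij hab
    · exact absurd hij (ha _ (by omega))
    · exact key _ _ (by assumption) (by assumption) (by assumption) (by assumption) hij
    · exact absurd hij (hb _ (by omega))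
    · exact absurd hij.symm hab
    · exact absurd hij.symm (hb _ (by omega))
    · omega
  · intro i hi j hj hij
    simp only [Set.mem_Iio] at hi hj
    dsimp only at hij
    have key : ∀ i j, i ≤ p → j ≤ p → ¬ i = 0 → ¬ j = 0 → e (i - 1) = e (j - 1) →
        i = j := by
      intro i j hi hj hi0 hj0 hij
      have := h.edge_inj (Set.mem_Iio.2 (by omega)) (Set.mem_Iio.2 (by omega)) hij
      omega
    split_ifs at hij with h1 h2 h3 h4 h5 h6 h7 h8
    · omega
    · exact absurd hij.symm (hfe _ (by omega))
    · exact absurd hij hfg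
    · exact absurd hij (hfe _ (by omega))
    · exact key _ _ (by assumption) (by assumption) (by assumption) (by assumption) hij
    · exact absurd hij (hge _ (by omega))
    · exact absurd hij.symm hfg
    · exact absurd hij.symm (hge _ (by omega))
    · omega
  · intro i hi
    split_ifs
    · exact hf
    · exact h.edge_mem _ (by omega)
    · exact hg
  · intro i hi
    rcases i with _ | i
    · simpa using haf
    · by_cases h1 : i + 1 ≤ p
      · simpa [h1, show i ≤ p by omega] using h.left_mem i (by omega)
      · obtain rfl : i = p := by omega
        simpa using hpg
  · intro i hi
    rcases i with _ | i
    · simpa using h0f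
    · by_cases h1 : i + 1 ≤ p
      · simpa [h1, show i ≤ p by omega] using h.right_mem i (by omega)
      · obtain rfl : i = p := by omega
        simpa using hbg

/-! ### Layerings -/

/-- `lvl` arranges some vertices in levels `0, …, t` around `x` (the other vertices have level `⊤`).
Every vertex `v` of positive level has a parent one level below, joined to it by a hyperedge
`link v`, and different vertices have different links. A hyperedge with a vertex `u` below level `t`
lies in the levels up to `lvl u + 1`, unless it is a link of a vertex in these levels. -/
structure IsLayering {α : Type*} (E : Finset (Finset α)) (x : α) (t : ℕ) (lvl : α → ℕ∞)
    (par : α → α) (link : α → Finset α) : Prop where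
  lvl_eq_zero : ∀ v, lvl v = 0 ↔ v = x
  lvl_le : ∀ v, lvl v ≠ ⊤ → lvl v ≤ t
  lvl_par : ∀ v (i : ℕ), lvl v = (i + 1 : ℕ) → lvl (par v) = i
  link_mem : ∀ v, v ≠ x → lvl v ≠ ⊤ → link v ∈ E
  self_mem : ∀ v, v ≠ x → lvl v ≠ ⊤ → v ∈ link v
  par_mem : ∀ v, v ≠ x → lvl v ≠ ⊤ → par v ∈ link v
  link_inj : ∀ u v, u ≠ x → v ≠ x → lvl u ≠ ⊤ → lvl v ≠ ⊤ → link u = link v → u = v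
  lvl_le_succ : ∀ e ∈ E, ∀ u ∈ e, lvl u < t →
    (∀ v, v ≠ x → lvl v ≤ lvl u + 1 → link v ≠ e) → ∀ v ∈ e, lvl v ≤ lvl u + 1

-- The new level consists of the vertices covered by a maximum matching between unreached vertices
-- and free hyperedges meeting level `t`. The matching keeps links distinct, and its maximality
-- gives `lvl_le_succ`.
open Classical in
lemma IsLayering.succ {α : Type*} {E : Finset (Finset α)} {x : α} {t : ℕ} {lvl : α → ℕ∞}
    {par : α → α} {link : α → Finset α} (h : IsLayering E x t lvl par link) :
    ∃ lvl' par' link', IsLayering E x (t + 1) lvl' par' link' := by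
  -- vertices to be reached, with a free hyperedge from level `t`
  let C : Finset (α × Finset α) := (E.biUnion fun e => e.image fun v => (v, e)).filter fun z =>
    lvl z.1 = ⊤ ∧ (∃ u ∈ z.2, lvl u = t) ∧ ∀ v, v ≠ x → lvl v ≠ ⊤ → link v ≠ z.2
  have hC : ∀ v e, (v, e) ∈ C ↔ e ∈ E ∧ v ∈ e ∧ lvl v = ⊤ ∧ (∃ u ∈ e, lvl u = t) ∧
      ∀ v, v ≠ x → lvl v ≠ ⊤ → link v ≠ e := by
    intro v e
    simp only [C, Finset.mem_filter, Finset.mem_biUnion, Finset.mem_image, Prod.mk.injEq]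
    constructor
    · rintro ⟨⟨e', he', v', hv', rfl, rfl⟩, h1⟩
      exact ⟨he', hv', h1⟩
    · rintro ⟨h1, h2, h3⟩
      exact ⟨⟨e, h1, v, h2, rfl, rfl⟩, h3⟩
  let good : Finset (Finset (α × Finset α)) := C.powerset.filter fun P =>
    ∀ y ∈ P, ∀ z ∈ P, (y.1 = z.1 ∨ y.2 = z.2) → y = z
  obtain ⟨P, hP, hmax⟩ := Finset.exists_max_image good Finset.card
    ⟨∅, by simp [good]⟩
  obtain ⟨hPC, hPm⟩ := Finset.mem_filter.1 hP
  rw [Finset.mem_powerset] at hPC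
  have hadd : ∀ v e, (v, e) ∈ C → (∃ e', (v, e') ∈ P) ∨ ∃ v', (v', e) ∈ P := by
    intro v e hve
    by_contra hcon
    push Not at hcon
    have hnot : (v, e) ∉ P := hcon.1 e
    have : insert (v, e) P ∈ good := by
      refine Finset.mem_filter.2 ⟨Finset.mem_powerset.2 (Finset.insert_subset hve hPC), ?_⟩
      intro y hy z hz hyz
      rcases Finset.mem_insert.1 hy with rfl | hy <;> rcases Finset.mem_insert.1 hz with rfl | hz
      · rfl
      · rcases hyz with h1 | h1
        · exact absurd (show (v, z.2) ∈ P by rw [show v = z.1 from h1]; exact hz) (hcon.1 _)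
        · exact absurd (show (z.1, e) ∈ P by rw [show e = z.2 from h1]; exact hz) (hcon.2 _)
      · rcases hyz with h1 | h1
        · exact absurd (show (v, y.2) ∈ P by rw [show v = y.1 from h1.symm]; exact hy) (hcon.1 _)
        · exact absurd (show (y.1, e) ∈ P by rw [show e = y.2 from h1.symm]; exact hy) (hcon.2 _)
      · exact hPm y hy z hz hyz
    have := hmax _ this
    rw [Finset.card_insert_of_notMem hnot] at this
    omega
  let N : α → Prop := fun v => ∃ e, (v, e) ∈ P
  have hNx : ∀ v, N v → lvl v = ⊤ := fun v ⟨e, he⟩ => ((hC v e).1 (hPC he)).2.2.1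
  choose! m hm using (fun v (hv : N v) => hv : ∀ v, N v → ∃ e, (v, e) ∈ P)
  have hmC := fun v (hv : N v) => (hC v (m v)).1 (hPC (hm v hv))
  choose! w hw using fun v (hv : N v) => (hmC v hv).2.2.2.1
  have hx0 : lvl x = 0 := (h.lvl_eq_zero x).2 rfl
  have hNnx : ∀ v, N v → v ≠ x := by
    rintro v hv rfl
    have := hNx v hv
    simp [hx0] at this
  let lvl' : α → ℕ∞ := fun v => if N v then (t + 1 : ℕ) else lvl v
  have lN : ∀ v, N v → lvl' v = (t + 1 : ℕ) := fun v hv => if_pos hv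
  have lnN : ∀ v, ¬ N v → lvl' v = lvl v := fun v hv => if_neg hv
  have lold : ∀ v, lvl v ≠ ⊤ → ¬ N v := fun v hv hN => hv (hNx v hN)
  have lle : ∀ v, lvl' v ≤ t → ¬ N v := fun v hv hN => by
    rw [lN v hN] at hv
    have : t + 1 ≤ t := by exact_mod_cast hv
    omega
  refine ⟨lvl', fun v => if N v then w v else par v, fun v => if N v then m v else link v,
    ?_, ?_, ?_, ?_, ?_, ?_, ?_, ?_⟩
  · intro v
    by_cases hv : N v
    · rw [lN v hv]
      exact iff_of_false (by exact_mod_cast (Nat.succ_ne_zero t)) (hNnx v hv)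
    · rw [lnN v hv]
      exact h.lvl_eq_zero v
  · intro v hv
    by_cases hN : N v
    · rw [lN v hN]
    · rw [lnN v hN] at hv ⊢
      exact (h.lvl_le v hv).trans (by exact_mod_cast Nat.le_succ t)
  · intro v i hv
    by_cases hN : N v
    · rw [if_pos hN]
      rw [lN v hN] at hv
      have : t + 1 = i + 1 := by exact_mod_cast hv
      obtain rfl : t = i := by omega
      have := (hw v hN).2
      rw [lnN _ (lold _ (by rw [this]; exact ENat.natCast_ne_top t))]
      exact this
    · rw [if_neg hN]
      rw [lnN v hN] at hv
      have := h.lvl_par v i hv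
      rw [lnN _ (lold _ (by rw [this]; exact ENat.natCast_ne_top i))]
      exact this
  · intro v hvx hv
    by_cases hN : N v
    · rw [if_pos hN]
      exact (hmC v hN).1
    · rw [if_neg hN]
      rw [lnN v hN] at hv
      exact h.link_mem v hvx hv
  · intro v hvx hv
    by_cases hN : N v
    · rw [if_pos hN]
      exact (hmC v hN).2.1
    · rw [if_neg hN]
      rw [lnN v hN] at hv
      exact h.self_mem v hvx hv
  · intro v hvx hv
    by_cases hN : N v
    · rw [if_pos hN, if_pos hN]
      exact (hw v hN).1
    · rw [if_neg hN, if_neg hN]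
      rw [lnN v hN] at hv
      exact h.par_mem v hvx hv
  · intro u v hux hvx hu hv huv
    split_ifs at huv with h1 h2 h2
    · have := hPm _ (hm u h1) _ (hm v h2) (Or.inr huv)
      exact congrArg Prod.fst this
    · rw [lnN v h2] at hv
      exact absurd huv.symm ((hmC u h1).2.2.2.2 v hvx hv)
    · rw [lnN u h1] at hu
      exact absurd huv ((hmC v h2).2.2.2.2 u hux hu)
    · rw [lnN v h2] at hv
      rw [lnN u h1] at hu
      exact h.link_inj u v hux hvx hu hv huv
  · intro e he u hu hut hfree v hv
    have hut' : lvl' u ≤ t := by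
      have : lvl' u < (t : ℕ∞) + 1 := by exact_mod_cast hut
      exact Order.le_of_lt_add_one this
    have huN := lle u hut'
    rw [lnN u huN] at hut' hfree ⊢
    have hunlinked : ∀ v, v ≠ x → ¬ N v → lvl v ≤ lvl u + 1 → link v ≠ e := by
      intro v hvx hvN hle
      have := hfree v hvx (by rwa [lnN v hvN])
      rwa [if_neg hvN] at this
    rcases hut'.lt_or_eq with hlt | heq
    · have hle : ∀ v, lvl v ≤ lvl u + 1 → ¬ N v := fun v hv => lold v (by
        intro htop
        rw [htop, top_le_iff] at hv
        have : lvl u ≠ ⊤ := (hlt.trans (ENat.natCast_lt_top t)).ne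
        simp [this] at hv)
      have := h.lvl_le_succ e he u hu hlt
        (fun v hvx hvle => hunlinked v hvx (hle v hvle) hvle) v hv
      rwa [lnN v (hle v this)]
    · by_cases hN : N v
      · rw [lN v hN, heq]
        norm_cast
      · rw [lnN v hN]
        by_cases htop : lvl v = ⊤
        · exfalso
          -- By maximality, either `v` is matched, or `e` is already the link of a vertex on the new
          -- level; both are excluded.
          have hve : (v, e) ∈ C := (hC v e).2 ⟨he, hv, htop, ⟨u, hu, heq⟩, fun v' hvx hv' => by
            refine hunlinked v' hvx (lold v' hv') ?_
            rw [heq]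
            exact (h.lvl_le v' hv').trans le_self_add⟩
          rcases hadd v e hve with hv' | ⟨v', hv'⟩
          · exact hN hv'
          · have hNv' : N v' := ⟨e, hv'⟩
            refine hfree v' (hNnx v' hNv') ?_ ?_
            · rw [lN v' hNv', heq]
              norm_cast
            · rw [if_pos hNv']
              exact congrArg Prod.snd (hPm _ (hm v' hNv') _ hv' (Or.inl rfl))
        · rw [heq]
          exact (h.lvl_le v htop).trans le_self_add

open Classical in
lemma exists_isLayering {α : Type*} (E : Finset (Finset α)) (x : α) (t : ℕ) :
    ∃ lvl par link, IsLayering E x t lvl par link := by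
  induction t with
  | zero =>
    -- Nothing is required of parents and links at `x` or at level `⊤`, so `id` and `∅` are junk
    -- values.
    refine ⟨fun v => if v = x then 0 else ⊤, id, fun _ => ∅, ?_, ?_, ?_, ?_, ?_, ?_, ?_, ?_⟩
    · intro v
      by_cases h : v = x <;> simp [h]
    · intro v
      by_cases h : v = x <;> simp [h]
    · intro v i hv
      by_cases h : v = x
      · simp only [h, if_true] at hv
        exact absurd hv.symm (by exact_mod_cast Nat.succ_ne_zero i)
      · simp only [h, if_false] at hv
        exact absurd hv.symm (ENat.natCast_ne_top _)
    · intro v h hv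
      simp [h] at hv
    · intro v h hv
      simp [h] at hv
    · intro v h hv
      simp [h] at hv
    · intro u v h _ hu
      simp [h] at hu
    · intro e _ u _ hu
      simp at hu
  | succ t ih =>
    obtain ⟨_, _, _, h⟩ := ih
    exact h.succ

/-- Climb down a layering from both ends of a Berge path until the two branches meet. -/
lemma IsLayering.exists_cyclic {α : Type*} {E : Finset (Finset α)} {x : α} {t : ℕ} {lvl : α → ℕ∞}
    {par : α → α} {link : α → Finset α} (h : IsLayering E x t lvl par link) (j : ℕ) :
    ∀ (l p : ℕ) (q : ℕ → α) (e : ℕ → Finset α), j < l → IsBergePath E p q e →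
      (∀ i ≤ p, l ≤ lvl (q i)) → lvl (q 0) = l → lvl (q p) = l →
      (∀ i < p, ∀ v, v ≠ x → lvl v ≠ ⊤ → link v = e i → l < lvl v) →
      par^[j] (q 0) ≠ par^[j] (q p) → par^[j + 1] (q 0) = par^[j + 1] (q p) →
      HasCyclicBerge E (p + 2 * j + 2) := by
  have facts : ∀ (l : ℕ) (v : α), 0 < l → lvl v = l → v ≠ x ∧ lvl v ≠ ⊤ ∧
      lvl (par v) = (l - 1 : ℕ) := by
    intro l v hl hv
    refine ⟨?_, ?_, h.lvl_par v (l - 1) (by rw [hv, Nat.sub_add_cancel hl])⟩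
    · rintro rfl
      rw [(h.lvl_eq_zero v).2 rfl] at hv
      have : 0 = l := by exact_mod_cast hv
      omega
    · rw [hv]
      exact ENat.natCast_ne_top l
  induction j with
  | zero =>
    intro l p q e hjl hP hlvl h0 hp hlink hne heq
    simp only [Function.iterate_zero, id, zero_add, Function.iterate_one] at hne heq
    obtain ⟨x0, t0, p0⟩ := facts l (q 0) hjl h0
    obtain ⟨xp, tp, pp⟩ := facts l (q p) hjl hp
    refine hP.close (w := par (q 0)) (f := link (q p)) (g := link (q 0)) ?_ (h.link_mem _ xp tp)
      (h.link_mem _ x0 t0) ?_ ?_ ?_ (h.self_mem _ xp tp) ?_ (h.par_mem _ x0 t0)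
      (h.self_mem _ x0 t0)
    · intro i hi hcon
      have := hlvl i hi
      rw [hcon, p0] at this
      have : l ≤ l - 1 := by exact_mod_cast this
      omega
    · exact fun hcon => hne (h.link_inj _ _ x0 xp t0 tp hcon.symm)
    · intro i hi hcon
      have := hlink i hi _ xp tp hcon.symm
      exact absurd hp this.ne'
    · intro i hi hcon
      have := hlink i hi _ x0 t0 hcon.symm
      exact absurd h0 this.ne'
    · rw [heq]
      exact h.par_mem _ xp tp
  | succ j ih =>
    intro l p q e hjl hP hlvl h0 hp hlink hne heq
    obtain ⟨x0, t0, p0⟩ := facts l (q 0) (by omega) h0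
    obtain ⟨xp, tp, pp⟩ := facts l (q p) (by omega) hp
    rw [Function.iterate_succ_apply, Function.iterate_succ_apply] at hne heq
    have hlow : ∀ a, lvl a = (l - 1 : ℕ) → ∀ i ≤ p, q i ≠ a := by
      intro a ha i hi hcon
      have := hlvl i hi
      rw [hcon, ha] at this
      have : l ≤ l - 1 := by exact_mod_cast this
      omega
    -- The links of the two ends are new, as links on the path belong to levels above `l`. After the
    -- extension the same holds with `l - 1`.
    have hext := hP.extend (a := par (q 0)) (b := par (q p)) (f := link (q 0)) (g := link (q p))
      (hlow _ p0) (hlow _ pp) (fun hcon => hne (by rw [hcon])) (h.link_mem _ x0 t0)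
      (h.link_mem _ xp tp)
      (fun hcon => hne (by rw [h.link_inj _ _ x0 xp t0 tp hcon]))
      (fun i hi hcon => absurd h0 (hlink i hi _ x0 t0 hcon.symm).ne')
      (fun i hi hcon => absurd hp (hlink i hi _ xp tp hcon.symm).ne')
      (h.par_mem _ x0 t0) (h.self_mem _ x0 t0) (h.self_mem _ xp tp) (h.par_mem _ xp tp)
    have hl : ((l - 1 : ℕ) : ℕ∞) < l := by exact_mod_cast (by omega : l - 1 < l)
    have := ih (l - 1) (p + 2) _ _ (by omega) hext ?_ (by simpa using p0) (by simpa using pp) ?_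
      (by simpa using hne) (by simpa using heq)
    · rwa [show p + 2 + 2 * j + 2 = p + 2 * (j + 1) + 2 by ring] at this
    · intro i hi
      split_ifs
      · exact p0.ge
      · exact hl.le.trans (hlvl _ (by omega))
      · exact pp.ge
    · intro i hi v hvx hvt hv
      split_ifs at hv
      · rw [h.link_inj _ _ hvx x0 hvt t0 hv, h0]
        exact hl
      · exact hl.trans (hlink _ (by omega) v hvx hvt hv)
      · rw [h.link_inj _ _ hvx xp hvt tp hv, hp]
        exact hl

/-! ### Counting hyperedges on a level -/

open Classical in
/-- The vertices of `V` on level `i`. -/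
noncomputable def levelSet {α : Type*} (V : Finset α) (lvl : α → ℕ∞) (i : ℕ) : Finset α :=
  V.filter fun v => lvl v = i

open Classical in
/-- The hyperedges which are not links and have at least two vertices on level `i`. -/
noncomputable def denseFree {α : Type*} (V : Finset α) (E : Finset (Finset α)) (x : α)
    (lvl : α → ℕ∞) (link : α → Finset α) (i : ℕ) : Finset (Finset α) :=
  E.filter fun e => (∀ v, v ≠ x → lvl v ≠ ⊤ → link v ≠ e) ∧ 2 ≤ (e ∩ levelSet V lvl i).card

lemma mem_levelSet {α : Type*} {V : Finset α} {lvl : α → ℕ∞} {i : ℕ} {v : α} :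
    v ∈ levelSet V lvl i ↔ v ∈ V ∧ lvl v = i := by
  simp [levelSet]

lemma IsLayering.iterate_par {α : Type*} {E : Finset (Finset α)} {x : α} {t : ℕ} {lvl : α → ℕ∞}
    {par : α → α} {link : α → Finset α} (h : IsLayering E x t lvl par link) (i : ℕ) :
    ∀ v, lvl v = i → par^[i] v = x := by
  induction i with
  | zero => exact fun v hv => (h.lvl_eq_zero v).1 (by simpa using hv)
  | succ i ih => exact fun v hv =>
      (Function.iterate_succ_apply par i v).trans (ih _ (h.lvl_par v i hv))

open Classical in
/-- A level carries few hyperedges outside the tree, if there is no Berge cycle of length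
`2k + 1`. -/
lemma IsLayering.card_denseFree_le {α : Type*} {V : Finset α} {E : Finset (Finset α)} {x : α}
    {t : ℕ} {lvl : α → ℕ∞} {par : α → α} {link : α → Finset α}
    (h : IsLayering E x t lvl par link) (hlin : ∀ e ∈ E, ∀ f ∈ E, e ≠ f → (e ∩ f).card ≤ 1)
    {k : ℕ} (hk : 2 ≤ k) (hfree : ¬ HasCyclicBerge E (2 * k + 1)) {i : ℕ} (hik : i ≤ k) :
    (denseFree V E x lvl link i).card ≤ (2 * k - 2) * (levelSet V lvl i).card := by
  by_contra hcon
  push Not at hcon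
  set U := denseFree V E x lvl link i with hU
  set S := levelSet V lvl i with hS
  have hUmem : ∀ e ∈ U, e ∈ E ∧ (∀ v, v ≠ x → lvl v ≠ ⊤ → link v ≠ e) ∧ 2 ≤ (e ∩ S).card :=
    fun e he => Finset.mem_filter.1 he
  have hpair : ∀ e ∈ U, ∃ s ⊆ e ∩ S, s.card = 2 := fun e he =>
    Finset.exists_subset_card_eq (hUmem e he).2.2
  choose! pr hpr hpr2 using hpair
  have hinj : Set.InjOn pr U := by
    intro e he f hf hef
    by_contra hne
    have h1 := hlin e (hUmem e he).1 f (hUmem f hf).1 hne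
    have h2 : pr e ⊆ e ∩ f := Finset.subset_inter
      ((hpr e he).trans Finset.inter_subset_left)
      (hef ▸ (hpr f hf).trans Finset.inter_subset_left)
    have h3 := Finset.card_le_card h2
    rw [hpr2 e he] at h3
    omega
  set P := U.image pr with hP
  have hg : ∀ s ∈ P, ∃ e ∈ U, pr e = s := fun s hs => by simpa [hP] using hs
  choose! g hgU hgpr using hg
  have hPS : ∀ s ∈ P, s ⊆ S := fun s hs => by
    rw [← hgpr s hs]
    exact (hpr _ (hgU s hs)).trans Finset.inter_subset_right
  have hPg : ∀ s ∈ P, s ⊆ g s := fun s hs => by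
    have := (hpr _ (hgU s hs)).trans Finset.inter_subset_left
    rwa [hgpr s hs] at this
  -- Density `2 * k - 2` makes the cycle at least `2k` long, hence longer than any path needed,
  -- whose length is at most `2k - 1`.
  obtain ⟨L, c, r, hL, hr2, hrL, hc, hch⟩ := exists_chorded_cycle S P (2 * k - 2) (by omega)
    (fun s hs => by rw [← hgpr s hs]; exact hpr2 _ (hgU s hs)) hPS
    (by rwa [hP, Finset.card_image_of_injOn hinj])
  have hcS : ∀ z, lvl (c z) = i := fun z =>
    (mem_levelSet.1 (hPS _ (hc.2 z).2 (by simp))).2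
  have hex : ∃ j, ∀ a b, par^[j] (c a) = par^[j] (c b) :=
    ⟨i, fun a b => by rw [h.iterate_par i _ (hcS a), h.iterate_par i _ (hcS b)]⟩
  have hfi : Nat.find hex ≤ i := Nat.find_min' hex fun a b => by
    rw [h.iterate_par i _ (hcS a), h.iterate_par i _ (hcS b)]
  have hf0 : Nat.find hex ≠ 0 := by
    intro h0
    have := Nat.find_spec hex
    rw [h0] at this
    exact (hc.2 0).1 (this 0 (0 + 1))
  -- Since `j + 1 ≤ i ≤ k`, the subtraction `k - 1 - j` below does not truncate.
  obtain ⟨j, hj⟩ := Nat.exists_eq_succ_of_ne_zero hf0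
  have hj1 : ∀ a b, par^[j + 1] (c a) = par^[j + 1] (c b) := by
    have := Nat.find_spec hex
    rwa [hj] at this
  have hj0 := Nat.find_min hex (m := j) (by omega)
  push Not at hj0
  obtain ⟨a0, b0, hab⟩ := hj0
  obtain ⟨q, hq, hqc, hqne⟩ := exists_bichromatic_path
    (R := fun a b => a ≠ b ∧ {a, b} ∈ P)
    (fun a b hab => ⟨hab.1.symm, by rw [Finset.pair_comm]; exact hab.2⟩) hc hch hr2 hrL
    (fun v => par^[j] v = par^[j] (c a0)) ⟨a0, b0, by simpa using hab.symm⟩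
    (2 * (k - 1 - j) + 1) ⟨k - 1 - j, rfl⟩ (by omega)
  set p := 2 * (k - 1 - j) + 1 with hp
  have hql : ∀ n, lvl (q n) = i := fun n => by
    obtain ⟨z, hz⟩ := hqc n
    rw [hz, hcS]
  have hBP : IsBergePath E p q fun n => g {q n, q (n + 1)} := by
    refine ⟨hq.1, ?_, fun n hn => (hUmem _ (hgU _ (hq.2 n hn).2)).1,
      fun n hn => hPg _ (hq.2 n hn).2 (by simp), fun n hn => hPg _ (hq.2 n hn).2 (by simp)⟩
    intro n hn m hm hnm
    simp only [Set.mem_Iio] at hn hm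
    have hnm' : ({q n, q (n + 1)} : Finset α) = {q m, q (m + 1)} := by
      rw [← hgpr _ (hq.2 n hn).2, ← hgpr _ (hq.2 m hm).2]
      exact congrArg pr hnm
    have hidx : ∀ a b, a ≤ p → b ≤ p → q a = q b → a = b := fun a b ha hb hab =>
      hq.1 (Set.mem_Iic.2 ha) (Set.mem_Iic.2 hb) hab
    have h1 : q n ∈ ({q m, q (m + 1)} : Finset α) := hnm' ▸ (by simp)
    have h2 : q (n + 1) ∈ ({q m, q (m + 1)} : Finset α) := hnm' ▸ (by simp)
    rw [Finset.mem_insert, Finset.mem_singleton] at h1 h2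
    have h1' : n = m ∨ n = m + 1 :=
      h1.imp (hidx _ _ (by omega) (by omega)) (hidx _ _ (by omega) (by omega))
    have h2' : n + 1 = m ∨ n + 1 = m + 1 :=
      h2.imp (hidx _ _ (by omega) (by omega)) (hidx _ _ (by omega) (by omega))
    omega
  -- No hyperedge of the path is a link, so the condition on links is vacuous.
  have := h.exists_cyclic j i p q _ (by omega) hBP (fun n _ => (hql n).ge) (hql 0) (hql p)
    (fun n hn v hvx hvt hv => absurd hv ((hUmem _ (hgU _ (hq.2 n hn).2)).2.1 v hvx hvt))
    (fun hcon => hqne (by simp only [hcon]))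
    (by
      obtain ⟨z, hz⟩ := hqc 0
      obtain ⟨z', hz'⟩ := hqc p
      rw [hz, hz']
      exact hj1 z z')
  apply hfree
  rwa [show p + 2 * j + 2 = 2 * k + 1 by omega] at this

open Classical in
/-- How many vertices a hyperedge can have on level `i < t`, according to its type. -/
lemma IsLayering.card_inter_levelSet_le {α : Type*} {V : Finset α} {E : Finset (Finset α)} {x : α}
    {t : ℕ} {lvl : α → ℕ∞} {par : α → α} {link : α → Finset α}
    (h : IsLayering E x t lvl par link) (hsub : ∀ e ∈ E, e ⊆ V) (h3 : ∀ e ∈ E, e.card = 3)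
    {i : ℕ} (hi : i < t) {e : Finset α} (he : e ∈ E) :
    (e ∩ levelSet V lvl i).card ≤
      2 * (if e ∈ (levelSet V lvl (i + 1)).image link then 1 else 0) +
      2 * (if e ∈ (levelSet V lvl i).image link then 1 else 0) +
      ∑ j ∈ Finset.range i, (if e ∈ (levelSet V lvl j).image link then 1 else 0) +
      3 * (if e ∈ denseFree V E x lvl link i then 1 else 0) +
      (if e ∈ denseFree V E x lvl link (i + 1) then 1 else 0) +
      (if e ∈ denseFree V E x lvl link (i - 1) then 1 else 0) := by
  have hnat : ∀ v, lvl v ≠ ⊤ → ∃ j : ℕ, lvl v = j := fun v hv =>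
    (ENat.ne_top_iff_exists.1 hv).imp fun j hj => hj.symm
  by_cases hlink : ∃ v, v ≠ x ∧ lvl v ≠ ⊤ ∧ link v = e
  · obtain ⟨v, hvx, hvt, rfl⟩ := hlink
    obtain ⟨j, hj⟩ := hnat v hvt
    have hvl := h.self_mem v hvx hvt
    have hpl := h.par_mem v hvx hvt
    have hvS : v ∈ levelSet V lvl j := mem_levelSet.2 ⟨hsub _ he hvl, hj⟩
    have hvim : link v ∈ (levelSet V lvl j).image link := Finset.mem_image_of_mem _ hvS
    have hj0 : j ≠ 0 := by
      rintro rfl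
      exact hvx ((h.lvl_eq_zero v).1 (by simpa using hj))
    have hjp : lvl (par v) = (j - 1 : ℕ) := h.lvl_par v (j - 1) (by
      rw [hj, Nat.sub_add_cancel (Nat.pos_of_ne_zero hj0)])
    have hvi : j ≠ i → v ∉ levelSet V lvl i := fun hji hcon => hji (by
      have := (mem_levelSet.1 hcon).2
      rw [hj] at this
      exact_mod_cast this)
    have hpi : j - 1 ≠ i → par v ∉ levelSet V lvl i := fun hji hcon => hji (by
      have := (mem_levelSet.1 hcon).2
      rw [hjp] at this
      exact_mod_cast this)
    have hle2 : ∀ u ∈ link v, u ∉ levelSet V lvl i → (link v ∩ levelSet V lvl i).card ≤ 2 := by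
      intro u hu hun
      have : link v ∩ levelSet V lvl i ⊆ (link v).erase u := fun w hw => by
        rw [Finset.mem_inter] at hw
        exact Finset.mem_erase.2 ⟨fun hwu => hun (hwu ▸ hw.2), hw.1⟩
      have := Finset.card_le_card this
      rw [Finset.card_erase_of_mem hu, h3 _ he] at this
      exact this
    -- For `j < i` both `v` and its parent miss level `i`, for `j = i` the parent does, for `j = i +
    -- 1` it is `v`. Links from higher levels avoid level `i` altogether, by `lvl_le_succ`.
    rcases lt_trichotomy j i with hji | rfl | hji
    · have h1 : (link v ∩ levelSet V lvl i).card ≤ 1 := by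
        have hvp : par v ≠ v := by
          intro hcon
          rw [hcon, hj] at hjp
          have : j = j - 1 := by exact_mod_cast hjp
          omega
        have : link v ∩ levelSet V lvl i ⊆ ((link v).erase v).erase (par v) := fun w hw => by
          rw [Finset.mem_inter] at hw
          exact Finset.mem_erase.2 ⟨fun hwu => hpi (by omega) (hwu ▸ hw.2),
            Finset.mem_erase.2 ⟨fun hwu => hvi hji.ne (hwu ▸ hw.2), hw.1⟩⟩
        have := Finset.card_le_card this
        rw [Finset.card_erase_of_mem (Finset.mem_erase.2 ⟨hvp, hpl⟩),
          Finset.card_erase_of_mem hvl, h3 _ he] at this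
        exact this
      have h2 : 1 ≤ ∑ j ∈ Finset.range i,
          (if link v ∈ (levelSet V lvl j).image link then 1 else 0) := by
        refine le_trans ?_ (Finset.single_le_sum (fun _ _ => Nat.zero_le _)
          (Finset.mem_range.2 hji))
        rw [if_pos hvim]
      omega
    · have := hle2 _ hpl (hpi (by omega))
      rw [if_pos hvim]
      omega
    · rcases (by omega : j = i + 1 ∨ i + 1 < j) with rfl | hji'
      · have := hle2 _ hvl (hvi hji.ne')
        rw [if_pos hvim]
        omega
      · have : link v ∩ levelSet V lvl i = ∅ := by
          rw [Finset.eq_empty_iff_forall_notMem]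
          intro u hu
          rw [Finset.mem_inter, mem_levelSet] at hu
          obtain ⟨huv, _, hui⟩ := hu
          have := h.lvl_le_succ _ he u huv (by rw [hui]; exact_mod_cast hi) (by
            intro v' hvx' hle hcon
            have hvt' : lvl v' ≠ ⊤ := by
              intro htop
              rw [htop, hui] at hle
              have : (⊤ : ℕ∞) ≤ (i + 1 : ℕ) := by exact_mod_cast hle
              exact ENat.natCast_ne_top _ (top_le_iff.1 this)
            rw [h.link_inj _ _ hvx' hvx hvt' hvt hcon, hj, hui] at hle
            have : j ≤ i + 1 := by exact_mod_cast hle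
            omega) v hvl
          rw [hj, hui] at this
          have : j ≤ i + 1 := by exact_mod_cast this
          omega
        rw [this]
        simp
  · push Not at hlink
    by_cases hU : e ∈ denseFree V E x lvl link i
    · rw [if_pos hU]
      have := (Finset.card_le_card (Finset.inter_subset_left (s₁ := e)
        (s₂ := levelSet V lvl i))).trans_eq (h3 e he)
      omega
    · have hlt : (e ∩ levelSet V lvl i).card < 2 := by
        by_contra hcon
        exact hU (Finset.mem_filter.2 ⟨he, hlink, not_lt.1 hcon⟩)
      rcases Nat.eq_zero_or_pos (e ∩ levelSet V lvl i).card with h0 | hpos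
      · rw [h0]
        exact Nat.zero_le _
      obtain ⟨u, hu⟩ := Finset.card_pos.1 hpos
      rw [Finset.mem_inter, mem_levelSet] at hu
      obtain ⟨hue, huV, hui⟩ := hu
      have hclosed : ∀ a ∈ e, ∀ n : ℕ, n < t → lvl a = n → ∀ b ∈ e, ∃ m : ℕ, lvl b = m ∧
          m ≤ n + 1 := by
        intro a ha n hn hlv b hb
        have := h.lvl_le_succ e he a ha (by rw [hlv]; exact_mod_cast hn) (fun v hvx hle => by
          refine hlink v hvx ?_
          intro htop
          rw [htop, hlv] at hle
          have : (⊤ : ℕ∞) ≤ (n + 1 : ℕ) := by exact_mod_cast hle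
          exact ENat.natCast_ne_top _ (top_le_iff.1 this)) b hb
        rw [hlv] at this
        have hle : lvl b ≤ (n + 1 : ℕ) := by exact_mod_cast this
        obtain ⟨m, hm⟩ := hnat b (by
          intro htop
          rw [htop] at hle
          exact ENat.natCast_ne_top _ (top_le_iff.1 hle))
        rw [hm] at hle
        exact ⟨m, hm, by exact_mod_cast hle⟩
      obtain ⟨a, b, hab, hEab⟩ := Finset.card_eq_two.1 (show (e.erase u).card = 2 by
        rw [Finset.card_erase_of_mem hue, h3 e he])
      have haE : a ∈ e.erase u := by rw [hEab]; simp
      have hbE : b ∈ e.erase u := by rw [hEab]; simp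
      obtain ⟨hau, hae⟩ := Finset.mem_erase.1 haE
      obtain ⟨hbu, hbe⟩ := Finset.mem_erase.1 hbE
      have hnot : ∀ w ∈ e, w ≠ u → lvl w ≠ i := by
        intro w hw hwu hwi
        have : 1 < (e ∩ levelSet V lvl i).card := Finset.one_lt_card.2
          ⟨w, Finset.mem_inter.2 ⟨hw, mem_levelSet.2 ⟨hsub e he hw, hwi⟩⟩,
            u, Finset.mem_inter.2 ⟨hue, mem_levelSet.2 ⟨huV, hui⟩⟩, hwu⟩
        omega
      have hdense : ∀ n : ℕ, lvl a = n → lvl b = n → e ∈ denseFree V E x lvl link n := by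
        intro n ha hb
        refine Finset.mem_filter.2 ⟨he, hlink, Finset.one_lt_card.2 ⟨a, ?_, b, ?_, hab⟩⟩
        · exact Finset.mem_inter.2 ⟨hae, mem_levelSet.2 ⟨hsub e he hae, ha⟩⟩
        · exact Finset.mem_inter.2 ⟨hbe, mem_levelSet.2 ⟨hsub e he hbe, hb⟩⟩
      obtain ⟨la, hla, hlai⟩ := hclosed u hue i hi hui a hae
      obtain ⟨lb, hlb, hlbi⟩ := hclosed u hue i hi hui b hbe
      have hla' : la ≠ i := fun hcon => hnot a hae hau (by rw [hla, hcon])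
      have hlb' : lb ≠ i := fun hcon => hnot b hbe hbu (by rw [hlb, hcon])
      have hba : ∀ w ∈ e, ∀ w' ∈ e, ∀ n m : ℕ, lvl w = n → lvl w' = m → n < t → m ≤ n + 1 := by
        intro w hw w' hw' n m hn hm hnt
        obtain ⟨m', hm', hle⟩ := hclosed w hw n hnt hn w' hw'
        rw [hm] at hm'
        have : m = m' := by exact_mod_cast hm'
        omega
      have h1 := hba a hae u hue la i hla hui
      have h2 := hba b hbe u hue lb i hlb hui
      have h4 := hba a hae b hbe la lb hla hlb
      have h5 := hba b hbe a hae lb la hlb hla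
      -- Levels in `e` cannot jump from `i - 1` to `i + 1`, so `a` and `b` share a level. For `i =
      -- 0` the truncated `i - 1` is ruled out by `hla'`.
      rcases (by omega : (la = i + 1 ∧ lb = i + 1) ∨ (la = i - 1 ∧ lb = i - 1)) with
        ⟨ha, hb⟩ | ⟨ha, hb⟩
      · rw [if_pos (hdense (i + 1) (ha ▸ hla) (hb ▸ hlb))]
        omega
      · rw [if_pos (hdense (i - 1) (ha ▸ hla) (hb ▸ hlb))]
        omega

open Classical in
/-- The sum of the degrees on level `i` in terms of the sizes of the levels. -/
lemma IsLayering.sum_degree_le {α : Type*} {V : Finset α} {E : Finset (Finset α)} {x : α}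
    {k : ℕ} {lvl : α → ℕ∞} {par : α → α} {link : α → Finset α}
    (h : IsLayering E x k lvl par link) (hsub : ∀ e ∈ E, e ⊆ V) (h3 : ∀ e ∈ E, e.card = 3)
    (hlin : ∀ e ∈ E, ∀ f ∈ E, e ≠ f → (e ∩ f).card ≤ 1) (hk : 2 ≤ k)
    (hfree : ¬ HasCyclicBerge E (2 * k + 1)) {i : ℕ} (hi : i < k)
    (hmono : ∀ j ≤ i, (levelSet V lvl j).card ≤ (levelSet V lvl i).card) :
    ∑ v ∈ levelSet V lvl i, (E.filter fun e => v ∈ e).card ≤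
      2 * k * (levelSet V lvl (i + 1)).card + 9 * k * (levelSet V lvl i).card := by
  have hind : ∀ A : Finset (Finset α), ∑ e ∈ E, (if e ∈ A then 1 else 0) ≤ A.card := fun A => by
    rw [← Finset.card_filter]
    exact Finset.card_le_card fun e he => (Finset.mem_filter.1 he).2
  have himg : ∀ j, ∑ e ∈ E, (if e ∈ (levelSet V lvl j).image link then 1 else 0) ≤
      (levelSet V lvl j).card := fun j => (hind _).trans Finset.card_image_le
  have hden : ∀ j ≤ k, ∑ e ∈ E, (if e ∈ denseFree V E x lvl link j then 1 else 0) ≤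
      (2 * k - 2) * (levelSet V lvl j).card := fun j hj =>
    (hind _).trans (h.card_denseFree_le hlin hk hfree hj)
  have hdouble : ∑ v ∈ levelSet V lvl i, (E.filter fun e => v ∈ e).card =
      ∑ e ∈ E, (e ∩ levelSet V lvl i).card := by
    simp_rw [Finset.card_filter]
    rw [Finset.sum_comm]
    refine Finset.sum_congr rfl fun e _ => ?_
    rw [← Finset.card_filter, Finset.inter_comm, Finset.filter_mem_eq_inter]
  have hsum := Finset.sum_le_sum fun e (he : e ∈ E) => h.card_inter_levelSet_le hsub h3 hi he
  simp only [Finset.sum_add_distrib, ← Finset.mul_sum] at hsum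
  rw [Finset.sum_comm] at hsum
  have hold : ∑ j ∈ Finset.range i, ∑ e ∈ E,
      (if e ∈ (levelSet V lvl j).image link then 1 else 0) ≤ k * (levelSet V lvl i).card := by
    calc _ ≤ ∑ j ∈ Finset.range i, (levelSet V lvl i).card :=
          Finset.sum_le_sum fun j hj => (himg j).trans (hmono j (Finset.mem_range.1 hj).le)
      _ = i * (levelSet V lvl i).card := by simp
      _ ≤ _ := Nat.mul_le_mul_right _ hi.le
  have e1 := himg (i + 1)
  have e2 := himg i
  have e3 := hden i hi.le
  have e4 := hden (i + 1) hi
  have e5 := (hden (i - 1) (by omega)).trans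
    (Nat.mul_le_mul_left _ (hmono (i - 1) (Nat.sub_le _ _)))
  -- The weights total 2 + (2k - 2) = 2k on level `i + 1` and at most 2 + k + 4(2k - 2) = 9k - 6 on
  -- level `i`.
  obtain ⟨d, rfl⟩ : ∃ d, k = d + 1 := ⟨k - 1, by omega⟩
  rw [show 2 * (d + 1) - 2 = 2 * d by omega] at e3 e4 e5
  rw [hdouble]
  nlinarith

/-! ### Growth of the levels and the final bound -/

open Classical in
/-- The bound for finite families of triples. -/
lemma card_le_of_not_hasCyclicBerge {α : Type*} (V : Finset α) (E : Finset (Finset α)) (k : ℕ)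
    (hk : 2 ≤ k) (hsub : ∀ e ∈ E, e ⊆ V) (h3 : ∀ e ∈ E, e.card = 3)
    (hlin : ∀ e ∈ E, ∀ f ∈ E, e ≠ f → (e ∩ f).card ≤ 1)
    (hfree : ¬ HasCyclicBerge E (2 * k + 1)) :
    (E.card : ℝ) ≤ 2 * (k : ℝ) * (V.card : ℝ) ^ (1 + 1 / (k : ℝ)) + 9 * (k : ℝ) * V.card := by
  by_contra hcon
  push Not at hcon
  set n := V.card with hn
  set γ : ℝ := (n : ℝ) ^ (1 / (k : ℝ)) with hγ
  have hk0 : (0 : ℝ) < k := by positivity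
  have hpow : (n : ℝ) ^ (1 + 1 / (k : ℝ)) = n * γ := by
    -- The primed version is needed because `n` may still be 0 here.
    rw [Real.rpow_add' (by positivity) (by positivity), Real.rpow_one]
  rw [hpow] at hcon
  obtain ⟨W, hWV, ⟨x, hx⟩, hdeg⟩ := exists_large_min_degree V E (2 * k * γ + 9 * k)
    (fun e he => Finset.card_pos.1 (by rw [h3 e he]; norm_num)) hsub (by
      rw [← hn]
      linarith)
  have hn1 : (1 : ℝ) ≤ n := by
    exact_mod_cast Finset.card_pos.2 ⟨x, hWV hx⟩
  have hγ1 : 1 ≤ γ := Real.one_le_rpow hn1 (by positivity)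
  set E' := E.filter fun e => e ⊆ W with hE'
  have hE'E : E' ⊆ E := Finset.filter_subset _ _
  have hfree' : ¬ HasCyclicBerge E' (2 * k + 1) := by
    rintro ⟨e, v, he, hv, hinc⟩
    exact hfree ⟨e, v, he, hv, fun i hi => ⟨hE'E (hinc i hi).1, (hinc i hi).2⟩⟩
  obtain ⟨lvl, par, link, h⟩ := exists_isLayering E' x k
  set s : ℕ → ℝ := fun i => ((levelSet W lvl i).card : ℝ) with hs
  have hs0 : s 0 = 1 := by
    have : levelSet W lvl 0 = {x} := by
      ext v
      rw [mem_levelSet, Finset.mem_singleton, Nat.cast_zero, h.lvl_eq_zero]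
      exact ⟨fun hv => hv.2, fun hv => ⟨hv ▸ hx, hv⟩⟩
    simp [hs, this]
  have hstep : ∀ i < k, 0 < s i → (∀ j ≤ i, s j ≤ s i) → γ * s i < s (i + 1) := by
    intro i hi hpos hmono
    have hsum := h.sum_degree_le (V := W) (fun e he => (Finset.mem_filter.1 he).2)
      (fun e he => h3 e (hE'E he)) (fun e he f hf => hlin e (hE'E he) f (hE'E hf)) hk hfree' hi
      (fun j hj => Nat.cast_le.1 (hmono j hj))
    have hne : (levelSet W lvl i).Nonempty := Finset.card_pos.1 (Nat.cast_pos.1 hpos)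
    have hlow : (2 * k * γ + 9 * k) * s i <
        ((∑ v ∈ levelSet W lvl i, (E'.filter fun e => v ∈ e).card : ℕ) : ℝ) := by
      push_cast
      calc (2 * k * γ + 9 * k) * s i = ∑ v ∈ levelSet W lvl i, (2 * k * γ + 9 * k) := by
            rw [Finset.sum_const, nsmul_eq_mul, mul_comm]
        _ < _ := Finset.sum_lt_sum_of_nonempty hne fun v hv => hdeg v (mem_levelSet.1 hv).1
    have hup : ((∑ v ∈ levelSet W lvl i, (E'.filter fun e => v ∈ e).card : ℕ) : ℝ) ≤
        2 * k * s (i + 1) + 9 * k * s i := by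
      simp only [hs]
      exact_mod_cast hsum
    have : 2 * k * (γ * s i) < 2 * k * s (i + 1) := by linarith
    exact lt_of_mul_lt_mul_left this (by positivity)
  -- Monotonicity is carried along because `hstep` needs it. Strictness starts at `i = 1`, as `s 0 =
  -- γ ^ 0`.
  have hgrow : ∀ i ≤ k, γ ^ i ≤ s i ∧ (i ≠ 0 → γ ^ i < s i) ∧ ∀ j ≤ i, s j ≤ s i := by
    intro i
    induction i with
    | zero =>
      intro _
      refine ⟨by simp [hs0], by simp, fun j hj => ?_⟩
      rw [Nat.le_zero.1 hj]
    | succ i ih =>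
      intro hi
      obtain ⟨h1, _, h2⟩ := ih (by omega)
      have hpos : 0 < s i := lt_of_lt_of_le (by positivity) h1
      have hst := hstep i (by omega) hpos h2
      have hlt : γ ^ (i + 1) < s (i + 1) := by
        rw [pow_succ']
        exact (mul_le_mul_of_nonneg_left h1 (by positivity)).trans_lt hst
      refine ⟨hlt.le, fun _ => hlt, fun j hj => ?_⟩
      rcases (by omega : j = i + 1 ∨ j ≤ i) with rfl | hj
      · exact le_rfl
      · exact (h2 j hj).trans ((le_mul_of_one_le_left hpos.le hγ1).trans hst.le)
  have hfin := (hgrow k le_rfl).2.1 (by omega)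
  have hγk : γ ^ k = n := by
    rw [hγ, one_div, Real.rpow_inv_natCast_pow (by positivity) (by omega)]
  have hle : s k ≤ n := Nat.cast_le.2
    ((Finset.card_le_card (Finset.filter_subset _ _)).trans (Finset.card_le_card hWV))
  rw [hγk] at hfin
  linarith

theorem theorem3 {α : Type*} (k n : ℕ) (hk : 2 ≤ k)
    (H : Hypergraph α) (hfin : H.vertexSet.Finite) (hn : H.vertexSet.ncard = n)
    (huniform : H.IsUniform 3) (hlinear : H.IsLinear)
    (hfree : ¬ H.HasBergeCycle (2 * k + 1)) :
    (H.edgeSet.ncard : ℝ) ≤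
      2 * (k : ℝ) * (n : ℝ) ^ (1 + 1 / (k : ℝ)) + 9 * (k : ℝ) * (n : ℝ) := by
  classical
  set V := hfin.toFinset with hV
  set E : Finset (Finset α) := V.powerset.filter fun e => (e : Set α) ∈ H.edgeSet with hE
  have hmem : ∀ e ∈ E, (e : Set α) ∈ H.edgeSet := fun e he => (Finset.mem_filter.1 he).2
  have hEcard : H.edgeSet.ncard = E.card := by
    have : H.edgeSet = (fun e : Finset α => (e : Set α)) '' E := by
      ext e
      constructor
      · intro he
        have hef := (huniform e he).1
        refine ⟨hef.toFinset, ?_, by simp⟩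
        refine Finset.mem_coe.2 (Finset.mem_filter.2 ⟨Finset.mem_powerset.2 ?_, by simpa using he⟩)
        intro v hv
        rw [hV, Set.Finite.mem_toFinset]
        exact H.subset_vertexSet_of_mem_edgeSet' he (by simpa using hv)
      · rintro ⟨e, he, rfl⟩
        exact hmem e he
    rw [this, Set.ncard_image_of_injective _ Finset.coe_injective, Set.ncard_coe_finset]
  have hVcard : V.card = n := by
    rw [← hn, Set.ncard_eq_toFinset_card _ hfin]
  have key := card_le_of_not_hasCyclicBerge V E k hk
    (fun e he => Finset.mem_powerset.1 (Finset.mem_filter.1 he).1)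
    (fun e he => by
      have := (huniform _ (hmem e he)).2
      rwa [Set.ncard_coe_finset] at this)
    (fun e he f hf hef => by
      rw [Finset.card_le_one]
      intro a ha b hb
      exact hlinear _ (hmem e he) _ (hmem f hf) (fun hc => hef (Finset.coe_injective hc))
        (by simpa using ha) (by simpa using hb))
    (by
      rintro ⟨e, v, he, hv, hinc⟩
      refine hfree ⟨fun i => (e i : Set α), fun i => hmem _ (hinc i i.2).1, ?_,
        fun i => v i, ?_, ?_⟩
      · intro i j hij
        exact Fin.ext (he i.2 j.2 (Finset.coe_injective hij))
      · intro i j hij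
        exact Fin.ext (hv i.2 j.2 hij)
      · intro i
        have hrot : ((finRotate (2 * k + 1) i : Fin (2 * k + 1)) : ℕ) =
            ((i : ℕ) + 1) % (2 * k + 1) := by
          rw [finRotate_apply, Fin.val_add]
          simp
        rw [Set.insert_subset_iff, Set.singleton_subset_iff]
        dsimp only
        rw [hrot]
        exact ⟨(hinc i i.2).2.1, (hinc i i.2).2.2⟩)
  rw [hEcard]
  rwa [hVcard] at key
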